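/- For $n\ge 1$ let $\sigma=(\sigma_1,\dots,\sigma_n):\mathbb C^n\to\mathbb C^n$, where $\sigma_k(z)=\sum_{1\le j_1<\dots<j_k\le n}z_{j_1}\cdots z_{j_k}$, and let $\mathbb G_n=\sigma(\mathbb D^n)$ be the symmetrized $n$-disc, where $\mathbb D\subset\mathbb C$ is the open unit disc. A domain (nonempty connected open set) $D\subset\mathbb C^n$ is called $\mathbb C$-convex if every nonempty intersection of $D$ with a complex affine line is connected and simply connected; it is called linearly convex if each point of $\mathbb C^n\setminus D$ lies on a complex affine hyperplane disjoint from $D$. Let $\mathcal E$ be the class of domains $D\subset\mathbb C^n$ that can be exhausted by domains biholomorphic to convex domains, i.e. for each compact $K\subset D$ there is a domain $D'$ with $K\subset D'\subset D$ that is biholomorphic to a convex domain in $\mathbb C^n$. (i) $\mathbb G_2$ is a $\mathbb C$-convex domain. Moreover $\mathbb G_2\notin\mathcal E$; in particular, $\mathbb G_2$ is a $\mathbb C$-convex domain that is not biholomorphic to any convex domain (a negative answer to Znamenskij's problem, whether every $\mathbb C$-convex domain is biholomorphic to a convex domain). (ii) For every $n\ge 3$, $\mathbb G_n$ is a linearly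 convex domain, but it is not $\mathbb C$-convex: there is a complex line $L$ such that $\mathbb G_n\cap L$ is disconnected. -/

import Mathlib

/-- The map `σ = (σ₁, …, σₙ) : ℂⁿ → ℂⁿ` of elementary symmetric polynomials; the coordinate with
(zero-based) index `k` is the elementary symmetric polynomial of degree `k + 1`. -/
def symmMap (n : ℕ) (z : Fin n → ℂ) : Fin n → ℂ :=
  fun k => ∑ t ∈ Finset.powersetCard ((k : ℕ) + 1) (Finset.univ : Finset (Fin n)), ∏ j ∈ t, z j

/-- The symmetrized `n`-disc: the image under `σ` of the open unit polydisc. -/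
def symmetrizedDisc (n : ℕ) : Set (Fin n → ℂ) :=
  symmMap n '' {z | ∀ j, ‖z j‖ < 1}

/-- A domain in `ℂⁿ`: a nonempty connected open set. -/
def IsDomainIn {n : ℕ} (D : Set (Fin n → ℂ)) : Prop :=
  IsOpen D ∧ IsConnected D

/-- A complex (affine) line in `ℂⁿ`. -/
def IsComplexLine {n : ℕ} (L : Set (Fin n → ℂ)) : Prop :=
  ∃ a v : Fin n → ℂ, v ≠ 0 ∧ L = {w | ∃ t : ℂ, w = a + t • v}

/-- A complex (affine) hyperplane in `ℂⁿ`. -/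
def IsComplexHyperplane {n : ℕ} (H : Set (Fin n → ℂ)) : Prop :=
  ∃ (l : (Fin n → ℂ) →ₗ[ℂ] ℂ) (c : ℂ), l ≠ 0 ∧ H = {w | l w = c}

/-- All (nonempty) intersections with complex lines are connected and simply connected. -/
def IsCConvex {n : ℕ} (D : Set (Fin n → ℂ)) : Prop :=
  ∀ L : Set (Fin n → ℂ), IsComplexLine L → (D ∩ L).Nonempty →
    IsConnected (D ∩ L) ∧ IsSimplyConnected (D ∩ L)

/-- Each point of the complement lies on a complex hyperplane disjoint from the set. -/
def IsLinearlyConvex {n : ℕ} (D : Set (Fin n → ℂ)) : Prop :=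
  ∀ z, z ∉ D → ∃ H : Set (Fin n → ℂ), IsComplexHyperplane H ∧ z ∈ H ∧ Disjoint H D

/-- The domain `D` is biholomorphic to the domain `G`. -/
def IsBiholomorphicTo {n : ℕ} (D G : Set (Fin n → ℂ)) : Prop :=
  ∃ f g : (Fin n → ℂ) → (Fin n → ℂ),
    DifferentiableOn ℂ f D ∧ DifferentiableOn ℂ g G ∧ Set.MapsTo f D G ∧ Set.MapsTo g G D ∧
      Set.LeftInvOn g f D ∧ Set.RightInvOn g f G

/-- `D` is biholomorphic to some convex domain. -/
def IsBiholomorphicToConvex {n : ℕ} (D : Set (Fin n → ℂ)) : Prop :=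
  ∃ G : Set (Fin n → ℂ), IsDomainIn G ∧ Convex ℝ G ∧ IsBiholomorphicTo D G

/-- The class `𝓔` of domains that can be exhausted by domains biholomorphic to convex domains:
each compact subset of `D` is contained in a subdomain of `D` biholomorphic to a convex domain. -/
def InClassE {n : ℕ} (D : Set (Fin n → ℂ)) : Prop :=
  IsDomainIn D ∧ ∀ K : Set (Fin n → ℂ), IsCompact K → K ⊆ D →
    ∃ D' : Set (Fin n → ℂ), IsDomainIn D' ∧ K ⊆ D' ∧ D' ⊆ D ∧ IsBiholomorphicToConvex D'

/-! By Vieta, `s` lies in the symmetrized disc iff `rootForm s w ≠ 0` for all `‖w‖ ≤ 1`. Since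
`rootForm` is affine in `s`, its zero sets are the hyperplanes that give linear convexity, and
compactness of the closed disc gives openness.

For `n ≥ 3` the pencil `((1 - ζ)(1 + tw)^3 + (1 + ζ)(1 - tw)^3)/2` is a complex line of root forms.
It meets the domain at `ζ = ±1` but, for `1/√3 ≤ t < 1`, nowhere on `Re ζ = 0`, so the section is
disconnected.

For `n = 2`, an apolarity argument of Grace type (`norm_lt_one_of_apolar`) shows that a line meeting
the domain contains some `(2f, f²)` with `‖f‖ < 1`. A Möbius automorphism moves this point to `0`,
and the domain is star-shaped about `0`, so the section is contractible.

Suppose a convex `G` is biholomorphic to a subdomain containing a large compact set. Discs `t ↦ (t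
a₀, t² a₁)` can then be averaged in `G` and pulled back. Comparing second-order terms and applying a
Schwarz lemma (`norm_two_mul_sub_le_of_disc`) bounds their midpoints, corrected by a single constant
`c` (`exists_shear_midpoint`). Two pairs of discs force `c` to be nearly `0`; a third pair excludes
this. -/

open ComplexConjugate Metric Filter Topology

/-! ### Root polynomials, openness and linear convexity. -/

/-- The polynomial `∏ (1 - w z_j)`, written in terms of the elementary symmetric coordinates. -/
def rootForm {n : ℕ} (s : Fin n → ℂ) (w : ℂ) : ℂ :=
  1 + ∑ k : Fin n, (-w) ^ ((k : ℕ) + 1) * s k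

theorem rootForm_symmMap {n : ℕ} (z : Fin n → ℂ) (w : ℂ) :
    rootForm (symmMap n z) w = ∏ j, (1 - w * z j) := by
  have h : ∏ j, (1 - w * z j) = ∏ j, (1 + (-w) * z j) := by
    refine Finset.prod_congr rfl fun j _ => by ring
  rw [h, Finset.prod_one_add, Finset.sum_powerset, Finset.sum_range_succ']
  simp only [Finset.card_univ, Fintype.card_fin, Finset.powersetCard_zero, Finset.sum_singleton,
    Finset.prod_empty]
  rw [Finset.sum_range (fun i => ∑ t ∈ Finset.powersetCard (i + 1) (Finset.univ : Finset (Fin n)),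
    ∏ j ∈ t, (-w) * z j), add_comm, rootForm]
  congr 1
  refine Finset.sum_congr rfl fun k _ => ?_
  rw [symmMap, Finset.mul_sum]
  refine Finset.sum_congr rfl fun t ht => ?_
  rw [Finset.prod_mul_distrib, Finset.prod_const, (Finset.mem_powersetCard.1 ht).2]

theorem symmMap_eq_esymm {n : ℕ} (z : Fin n → ℂ) (k : Fin n) :
    symmMap n z k = ((Finset.univ : Finset (Fin n)).val.map z).esymm ((k : ℕ) + 1) := by
  rw [Finset.esymm_map_val]; rfl

open Polynomial in
-- The coordinates `s`, with alternating signs, are the coefficients of a monic polynomial of degree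
-- `n`; it splits over `ℂ`, and Vieta recovers `s` from its roots.
theorem symmMap_surjective (n : ℕ) : Function.Surjective (symmMap n) := by
  intro s
  set q : ℂ[X] := ∑ k : Fin n, C ((-1) ^ ((k : ℕ) + 1) * s k) * X ^ (n - 1 - (k : ℕ)) with hq
  have hqd : q.degree < n := by
    rw [← Polynomial.mem_degreeLT]
    refine Submodule.sum_mem _ fun k _ => ?_
    rw [Polynomial.mem_degreeLT]
    refine (Polynomial.degree_C_mul_X_pow_le _ _).trans_lt ?_
    exact_mod_cast (by omega : n - 1 - (k : ℕ) < n)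
  set p : ℂ[X] := X ^ n + q with hp
  have hm : p.Monic := Polynomial.monic_X_pow_add hqd
  have hd : p.natDegree = n := by
    refine Polynomial.natDegree_eq_of_degree_eq_some ?_
    rw [hp, Polynomial.degree_add_eq_left_of_degree_lt (by simpa using hqd), Polynomial.degree_X_pow]
  have hc : p.roots.card = p.natDegree :=
    Polynomial.splits_iff_card_roots.1 (IsAlgClosed.splits p)
  have hlen : p.roots.toList.length = n := by rw [Multiset.length_toList, hc, hd]
  let z : Fin n → ℂ := fun j => p.roots.toList.get (Fin.cast hlen.symm j)
  have hz : (Finset.univ : Finset (Fin n)).val.map z = p.roots := by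
    have : List.ofFn z = p.roots.toList := by
      apply List.ext_get
      · simp [hlen]
      · intro i h1 h2
        simp [z]
    rw [← Multiset.coe_toList p.roots, ← this, Fin.univ_val_map]
  refine ⟨z, ?_⟩
  ext k
  rw [symmMap_eq_esymm, hz]
  have h1 := Polynomial.coeff_eq_esymm_roots_of_card hc (k := n - 1 - (k : ℕ)) (by omega)
  have h2 : n - (n - 1 - (k : ℕ)) = k + 1 := by omega
  rw [hd, hm.leadingCoeff, one_mul, h2] at h1
  have h3 : p.coeff (n - 1 - (k : ℕ)) = (-1) ^ ((k : ℕ) + 1) * s k := by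
    rw [hp, Polynomial.coeff_add, Polynomial.coeff_X_pow, if_neg (by omega), zero_add, hq,
      Polynomial.finsetSum_coeff, Finset.sum_eq_single k]
    · rw [Polynomial.coeff_C_mul_X_pow, if_pos rfl]
    · intro j _ hj
      rw [Polynomial.coeff_C_mul_X_pow, if_neg]
      intro h
      exact hj (Fin.ext (by omega))
    · simp
  rw [h3] at h1
  exact (mul_left_cancel₀ (pow_ne_zero _ (by norm_num)) h1).symm

theorem one_sub_mul_ne_zero_of_norm {w z : ℂ} (hw : ‖w‖ ≤ 1) (hz : ‖z‖ < 1) : 1 - w * z ≠ 0 := by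
  intro h
  have h1 : ‖w * z‖ = 1 := by rw [← sub_eq_zero.1 h, norm_one]
  rw [norm_mul] at h1
  nlinarith [norm_nonneg w, norm_nonneg z]

theorem norm_lt_one_of_rootForm_ne_zero {n : ℕ} {z : Fin n → ℂ}
    (h : ∀ w : ℂ, ‖w‖ ≤ 1 → rootForm (symmMap n z) w ≠ 0) (j : Fin n) : ‖z j‖ < 1 := by
  by_contra hj
  push Not at hj
  have h0 : z j ≠ 0 := fun h0 => by simp [h0] at hj; linarith
  refine h (z j)⁻¹ (by rw [norm_inv]; exact inv_le_one_of_one_le₀ hj) ?_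
  rw [rootForm_symmMap]
  exact Finset.prod_eq_zero (Finset.mem_univ j) (by rw [inv_mul_cancel₀ h0, sub_self])

theorem mem_symmetrizedDisc_iff {n : ℕ} {s : Fin n → ℂ} :
    s ∈ symmetrizedDisc n ↔ ∀ w : ℂ, ‖w‖ ≤ 1 → rootForm s w ≠ 0 := by
  constructor
  · rintro ⟨z, hz, rfl⟩ w hw
    rw [rootForm_symmMap]
    exact Finset.prod_ne_zero_iff.2 fun j _ => one_sub_mul_ne_zero_of_norm hw (hz j)
  · intro h
    obtain ⟨z, rfl⟩ := symmMap_surjective n s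
    exact ⟨z, norm_lt_one_of_rootForm_ne_zero h, rfl⟩

theorem continuous_symmMap (n : ℕ) : Continuous (symmMap n) := by
  unfold symmMap
  fun_prop

theorem isOpen_symmetrizedDisc (n : ℕ) : IsOpen (symmetrizedDisc n) := by
  have hc : Continuous fun x : (Fin n → ℂ) × ℂ => rootForm x.1 x.2 := by
    unfold rootForm
    fun_prop
  have h : symmetrizedDisc n =
      {s | ∀ w ∈ Metric.closedBall (0 : ℂ) 1, (s, w) ∈ {x : (Fin n → ℂ) × ℂ | rootForm x.1 x.2 ≠ 0}} := by
    ext s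
    simp [mem_symmetrizedDisc_iff]
  rw [h, isOpen_iff_eventually]
  intro s hs
  exact (isCompact_closedBall (0 : ℂ) 1).eventually_forall_of_forall_eventually fun w hw =>
    (isOpen_ne_fun hc continuous_const).mem_nhds (hs w hw)

theorem isDomainIn_symmetrizedDisc (n : ℕ) : IsDomainIn (symmetrizedDisc n) := by
  refine ⟨isOpen_symmetrizedDisc n, ?_⟩
  have h : {z : Fin n → ℂ | ∀ j, ‖z j‖ < 1} = Set.univ.pi fun _ => Metric.ball (0 : ℂ) 1 := by
    ext z; simp
  rw [symmetrizedDisc, h]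
  refine IsConnected.image ?_ _ (continuous_symmMap n).continuousOn
  exact isConnected_univ_pi.2 fun _ => (Metric.isConnected_ball one_pos)

theorem isLinearlyConvex_symmetrizedDisc (n : ℕ) : IsLinearlyConvex (symmetrizedDisc n) := by
  intro z hz
  rw [mem_symmetrizedDisc_iff] at hz
  push Not at hz
  obtain ⟨w, hw, h0⟩ := hz
  let l : (Fin n → ℂ) →ₗ[ℂ] ℂ := ∑ k : Fin n, (-w) ^ ((k : ℕ) + 1) • LinearMap.proj k
  have hl : ∀ s, l s = rootForm s w - 1 := fun s => by simp [l, rootForm]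
  refine ⟨{s | l s = -1}, ⟨l, -1, ?_, rfl⟩, by simp [hl, h0], ?_⟩
  · intro h
    have := hl z
    rw [h, h0] at this
    simp at this
  · rw [Set.disjoint_left]
    intro s hs hs'
    refine mem_symmetrizedDisc_iff.1 hs' w hw ?_
    have : l s = -1 := hs
    rw [hl] at this
    linear_combination this

/-! ### Low-dimensional formulas and a disconnected line section for `n ≥ 3`. -/

theorem symmMap_two (z : Fin 2 → ℂ) : symmMap 2 z = ![z 0 + z 1, z 0 * z 1] := by
  have h1 : Finset.powersetCard 1 (Finset.univ : Finset (Fin 2)) = {{0}, {1}} := by decide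
  have h2 : Finset.powersetCard 2 (Finset.univ : Finset (Fin 2)) = {{0, 1}} := by decide
  ext k
  fin_cases k
  · simp [symmMap, h1]
  · simp [symmMap, h2]

theorem symmMap_three (z : Fin 3 → ℂ) : symmMap 3 z =
    ![z 0 + z 1 + z 2, z 0 * z 1 + z 0 * z 2 + z 1 * z 2, z 0 * z 1 * z 2] := by
  have h1 : Finset.powersetCard 1 (Finset.univ : Finset (Fin 3)) = {{0}, {1}, {2}} := by decide
  have h2 : Finset.powersetCard 2 (Finset.univ : Finset (Fin 3)) = {{0, 1}, {0, 2}, {1, 2}} := by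
    decide
  have h3 : Finset.powersetCard 3 (Finset.univ : Finset (Fin 3)) = {{0, 1, 2}} := by decide
  ext k
  fin_cases k
  · simp [symmMap, h1, Finset.sum_insert]; ring
  · simp [symmMap, h2]
    rw [Finset.sum_insert (by decide), Finset.sum_insert (by decide)]
    simp; ring
  · simp [symmMap, h3]; ring

/-- The point of `ℂⁿ` with elementary symmetric coordinates `3tζ, 3t², t³ζ, 0, …, 0`. -/
def cubicPoint (n : ℕ) (t ζ : ℂ) : Fin n → ℂ := fun k =>
  if (k : ℕ) = 0 then 3 * t * ζ else if (k : ℕ) = 1 then 3 * t ^ 2 else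
    if (k : ℕ) = 2 then t ^ 3 * ζ else 0

theorem rootForm_cubicPoint {n : ℕ} (hn : 3 ≤ n) (t ζ w : ℂ) :
    rootForm (cubicPoint n t ζ) w =
      1 - 3 * t * ζ * w + 3 * t ^ 2 * w ^ 2 - t ^ 3 * ζ * w ^ 3 := by
  obtain ⟨m, rfl⟩ := Nat.exists_eq_add_of_le' hn
  simp only [rootForm, cubicPoint, Fin.sum_univ_succ, Fin.val_zero, Fin.val_succ]
  simp
  ring

theorem cubicPoint_mem_iff {n m : ℕ} (hn : 3 ≤ n) (hm : 3 ≤ m) (t ζ : ℂ) :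
    cubicPoint n t ζ ∈ symmetrizedDisc n ↔ cubicPoint m t ζ ∈ symmetrizedDisc m := by
  simp only [mem_symmetrizedDisc_iff, rootForm_cubicPoint hn, rootForm_cubicPoint hm]

theorem cubicPoint_mem_of_sq_eq_one {n : ℕ} (hn : 3 ≤ n) {t ζ : ℂ} (ht : ‖t‖ < 1)
    (hζ : ζ ^ 2 = 1) : cubicPoint n t ζ ∈ symmetrizedDisc n := by
  rw [mem_symmetrizedDisc_iff]
  intro w hw
  have hζ' : ‖ζ‖ = 1 := by
    have := congrArg norm hζ
    rw [norm_pow, norm_one] at this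
    exact (pow_eq_one_iff_of_nonneg (norm_nonneg _) two_ne_zero).1 this
  have h := one_sub_mul_ne_zero_of_norm hw (z := ζ * t) (by rw [norm_mul, hζ']; linarith)
  have : rootForm (cubicPoint n t ζ) w = (1 - w * (ζ * t)) ^ 3 := by
    rw [rootForm_cubicPoint hn]
    linear_combination (-3 * t ^ 2 * w ^ 2 + ζ * t ^ 3 * w ^ 3) * hζ
  rw [this]
  exact pow_ne_zero 3 h

/-- The cubic equation says that `(z + t)^3` and `(z - t)^3` are `ζ + 1` and `ζ - 1` times a common
factor. For imaginary `ζ` these moduli agree, so `z` is equidistant from `t` and `-t`. -/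
theorem re_eq_zero_of_cubic {t : ℝ} (ht : 0 < t) {z ζ : ℂ} (hζ : ζ.re = 0)
    (h : z ^ 3 - 3 * t * ζ * z ^ 2 + 3 * t ^ 2 * z - t ^ 3 * ζ = 0) : z.re = 0 := by
  have h1 : (z + t) ^ 3 = (ζ + 1) * (3 * t * z ^ 2 + t ^ 3) := by linear_combination h
  have h2 : (z - t) ^ 3 = (ζ - 1) * (3 * t * z ^ 2 + t ^ 3) := by linear_combination h
  have h3 : ‖ζ + 1‖ = ‖ζ - 1‖ := by
    rw [← sq_eq_sq₀ (norm_nonneg _) (norm_nonneg _), Complex.sq_norm, Complex.sq_norm,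
      Complex.normSq_apply, Complex.normSq_apply]
    simp [hζ]
  have h4 : ‖z + t‖ ^ 3 = ‖z - t‖ ^ 3 := by
    rw [← norm_pow, ← norm_pow, h1, h2, norm_mul, norm_mul, h3]
  have h5 := (pow_left_inj₀ (norm_nonneg _) (norm_nonneg _) three_ne_zero).1 h4
  rw [← sq_eq_sq₀ (norm_nonneg _) (norm_nonneg _), Complex.sq_norm, Complex.sq_norm,
      Complex.normSq_apply, Complex.normSq_apply] at h5
  simp at h5
  have : t * z.re = 0 := by linarith
  exact (mul_eq_zero.1 this).resolve_left ht.ne'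

theorem cubicPoint_notMem_of_re_eq_zero {n : ℕ} (hn : 3 ≤ n) {t : ℝ} (ht : 0 < t)
    (ht' : 1 ≤ 3 * t ^ 2) {ζ : ℂ} (hζ : ζ.re = 0) : cubicPoint n t ζ ∉ symmetrizedDisc n := by
  rw [cubicPoint_mem_iff hn le_rfl]
  rintro ⟨z, hz, h⟩
  rw [symmMap_three] at h
  have e1 : z 0 + z 1 + z 2 = 3 * t * ζ := by simpa [cubicPoint] using congrFun h 0
  have e2 : z 0 * z 1 + z 0 * z 2 + z 1 * z 2 = 3 * t ^ 2 := by
    simpa [cubicPoint] using congrFun h 1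
  have e3 : z 0 * z 1 * z 2 = t ^ 3 * ζ := by simpa [cubicPoint] using congrFun h 2
  have r0 : (z 0).re = 0 := by
    refine re_eq_zero_of_cubic ht hζ ?_
    linear_combination (z 0) ^ 2 * e1 - z 0 * e2 + e3
  have r1 : (z 1).re = 0 := by
    refine re_eq_zero_of_cubic ht hζ ?_
    linear_combination (z 1) ^ 2 * e1 - z 1 * e2 + e3
  have r2 : (z 2).re = 0 := by
    refine re_eq_zero_of_cubic ht hζ ?_
    linear_combination (z 2) ^ 2 * e1 - z 2 * e2 + e3
  have him : ∀ j, -1 < (z j).im ∧ (z j).im < 1 := fun j =>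
    abs_lt.1 ((Complex.abs_im_le_norm _).trans_lt (hz j))
  have h2 := congrArg Complex.re e2
  have hr : ((3 : ℂ) * (t : ℂ) ^ 2).re = 3 * t ^ 2 := by
    rw [show (3 : ℂ) * (t : ℂ) ^ 2 = ((3 * t ^ 2 : ℝ) : ℂ) by push_cast; ring, Complex.ofReal_re]
  rw [hr] at h2
  simp only [Complex.add_re, Complex.mul_re, r0, r1, r2] at h2
  -- For `z j = i y j`, adding `∏ (1 - y j) > 0` and `∏ (1 + y j) > 0` gives `2 + 2 e₂(y) > 0`,
  -- whereas `e₂(y) = -3t² ≤ -1`.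
  have p1 := mul_pos (mul_pos (sub_pos.2 (him 0).2) (sub_pos.2 (him 1).2)) (sub_pos.2 (him 2).2)
  have p2 := mul_pos (mul_pos (neg_lt_iff_pos_add.1 (him 0).1) (neg_lt_iff_pos_add.1 (him 1).1))
    (neg_lt_iff_pos_add.1 (him 2).1)
  nlinarith

theorem exists_line_inter_symmetrizedDisc_not_isPreconnected {n : ℕ} (hn : 3 ≤ n) :
    ∃ L : Set (Fin n → ℂ), IsComplexLine L ∧ ¬ IsPreconnected (symmetrizedDisc n ∩ L) := by
  -- Any `t` with `1/√3 ≤ t < 1` would serve.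
  let t : ℝ := 4 / 5
  have ht : 0 < t := by norm_num [t]
  let i0 : Fin n := ⟨0, by omega⟩
  let v : Fin n → ℂ := cubicPoint n t 1 - cubicPoint n t 0
  have hline : ∀ ζ : ℂ, cubicPoint n t 0 + ζ • v = cubicPoint n t ζ := by
    intro ζ
    ext k
    simp only [v, cubicPoint, Pi.add_apply, Pi.smul_apply, Pi.sub_apply, smul_eq_mul]
    split_ifs <;> ring
  have hv : v i0 = 3 * t := by simp [v, cubicPoint, i0]
  have ht0 : (3 * t : ℂ) ≠ 0 := by
    exact mul_ne_zero three_ne_zero (Complex.ofReal_ne_zero.2 ht.ne')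
  refine ⟨{w | ∃ ζ : ℂ, w = cubicPoint n t 0 + ζ • v}, ⟨_, v, ?_, rfl⟩, ?_⟩
  · intro h
    rw [h] at hv
    exact ht0 hv.symm
  · intro hpre
    have hc : Continuous fun w : Fin n → ℂ => (w i0).re := by fun_prop
    have hi0 : ∀ ζ : ℂ, (cubicPoint n t ζ i0).re = 3 * t * ζ.re := by
      intro ζ
      simp [cubicPoint, i0, Complex.mul_re]
    -- A connected section would have an interval as its image under the real part of the first
    -- coordinate. That interval contains `±3t`, hence `0`, which forces `Re ζ = 0`.
    have hord := (hpre.image _ hc.continuousOn).ordConnected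
    have htn : ‖(t : ℂ)‖ < 1 := by
      rw [Complex.norm_real, Real.norm_eq_abs, abs_of_pos ht]
      norm_num [t]
    have hm : ∀ ζ : ℂ, ζ ^ 2 = 1 → 3 * t * ζ.re ∈
        (fun w : Fin n → ℂ => (w i0).re) '' (symmetrizedDisc n ∩
          {w | ∃ ζ : ℂ, w = cubicPoint n t 0 + ζ • v}) := fun ζ hζ =>
      ⟨cubicPoint n t ζ, ⟨cubicPoint_mem_of_sq_eq_one hn htn hζ, ζ, (hline ζ).symm⟩, hi0 ζ⟩
    obtain ⟨w, ⟨hw, ζ, rfl⟩, h0⟩ := hord.out (hm (-1) (by norm_num)) (hm 1 (by norm_num))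
      (show (0 : ℝ) ∈ _ by constructor <;> simp <;> positivity)
    rw [hline] at hw h0
    simp only [hi0] at h0
    refine cubicPoint_notMem_of_re_eq_zero hn ht (by norm_num [t]) ?_ hw
    exact (mul_eq_zero.1 h0).resolve_left (by positivity)

theorem not_isCConvex_symmetrizedDisc {n : ℕ} (hn : 3 ≤ n) : ¬ IsCConvex (symmetrizedDisc n) := by
  intro h
  obtain ⟨L, hL, hL'⟩ := exists_line_inter_symmetrizedDisc_not_isPreconnected hn
  refine hL' ?_
  rcases (symmetrizedDisc n ∩ L).eq_empty_or_nonempty with he | hne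
  · rw [he]; exact isPreconnected_empty
  · exact (h L hL hne).1.isPreconnected

/-! ### `ℂ`-convexity of the symmetrized bidisc. -/

theorem rootForm_two (x : Fin 2 → ℂ) (w : ℂ) : rootForm x w = 1 - x 0 * w + x 1 * w ^ 2 := by
  simp [rootForm, Fin.sum_univ_succ]
  ring

theorem mem_symmetrizedBidisc_iff {x : Fin 2 → ℂ} : x ∈ symmetrizedDisc 2 ↔
    ∃ z₁ z₂ : ℂ, ‖z₁‖ < 1 ∧ ‖z₂‖ < 1 ∧ x 0 = z₁ + z₂ ∧ x 1 = z₁ * z₂ := by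
  constructor
  · rintro ⟨z, hz, rfl⟩
    exact ⟨z 0, z 1, hz 0, hz 1, by simp [symmMap_two], by simp [symmMap_two]⟩
  · rintro ⟨z₁, z₂, h₁, h₂, h0, h1⟩
    refine ⟨![z₁, z₂], fun j => by fin_cases j <;> simpa, ?_⟩
    rw [symmMap_two]
    ext j
    fin_cases j <;> simp [h0, h1]

theorem not_nonpos_mul_of_re_pos {a b : ℂ} (ha : 0 < a.re) (hb : 0 < b.re) {x : ℝ} (hx : x ≤ 0) :
    a * b ≠ x := by
  intro h
  have hre := congrArg Complex.re h
  have him := congrArg Complex.im h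
  simp only [Complex.mul_re, Complex.mul_im, Complex.ofReal_re, Complex.ofReal_im] at hre him
  have h1 : b.re * (a.re ^ 2 + a.im ^ 2) = a.re * x := by
    linear_combination a.re * hre + a.im * him
  have h2 : 0 < b.re * (a.re ^ 2 + a.im ^ 2) := by positivity
  nlinarith [mul_nonneg ha.le (neg_nonneg.2 hx)]

theorem one_sub_mul_re_pos {w z : ℂ} (hw : ‖w‖ ≤ 1) (hz : ‖z‖ < 1) : 0 < (1 - w * z).re := by
  have h1 : ‖w * z‖ < 1 := by
    rw [norm_mul]
    nlinarith [norm_nonneg w, norm_nonneg z]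
  have := (Complex.re_le_norm (w * z)).trans_lt h1
  simpa using this

theorem starConvex_symmetrizedBidisc : StarConvex ℝ 0 (symmetrizedDisc 2) := by
  rw [starConvex_zero_iff]
  intro x hx t ht0 ht1
  rcases ht0.eq_or_lt with rfl | ht
  · rw [zero_smul, mem_symmetrizedBidisc_iff]
    exact ⟨0, 0, by simp, by simp, by simp, by simp⟩
  obtain ⟨z₁, z₂, h₁, h₂, h0, h1⟩ := mem_symmetrizedBidisc_iff.1 hx
  rw [mem_symmetrizedDisc_iff]
  intro w hw h
  rw [rootForm_two] at h
  simp only [Pi.smul_apply, Complex.real_smul, h0, h1] at h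
  -- A zero `w` of the root form of `t • x` satisfies `(1 - w z₁)(1 - w z₂) = 1 - 1/t ≤ 0`, but two
  -- numbers in the right half-plane never have a nonpositive real product.
  refine not_nonpos_mul_of_re_pos (one_sub_mul_re_pos hw h₁) (one_sub_mul_re_pos hw h₂)
    (x := 1 - t⁻¹) (sub_nonpos.2 ((one_le_inv₀ ht).2 ht1)) ?_
  have htc : (t : ℂ) ≠ 0 := Complex.ofReal_ne_zero.2 ht.ne'
  push_cast
  field_simp
  linear_combination h

/-- Divided by `‖z - r₂‖²`, this determines the sign of the real part of `(1 - r̄₁ r₂)(z - r₁)/(z -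
r₂)`. -/
theorem re_harmonic_identity (z r₁ r₂ : ℂ) :
    (‖r₂‖ ^ 2 - 1) * ‖z - r₁‖ ^ 2 + (‖r₁‖ ^ 2 - 1) * ‖z - r₂‖ ^ 2 +
      2 * ((1 - conj r₁ * r₂) * ((z - r₁) * conj (z - r₂))).re =
    (‖z‖ ^ 2 - 1) * ‖r₁ - r₂‖ ^ 2 := by
  simp only [Complex.sq_norm, Complex.normSq_apply, Complex.mul_re, Complex.mul_im, Complex.sub_re,
    Complex.sub_im, Complex.conj_re, Complex.conj_im, Complex.one_re, Complex.one_im]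
  ring

/-- If both `r₁` and `r₂` lay outside the disc, a rotated multiple of `(z - r₁)/(z - r₂)` would map
the disc into the left half-plane; apolarity says that its values at `z₁` and `z₂` are opposite. -/
theorem norm_lt_one_of_apolar {z₁ z₂ r₁ r₂ : ℂ} (h₁ : ‖z₁‖ < 1) (h₂ : ‖z₂‖ < 1)
    (h : (z₁ - r₁) * (z₂ - r₂) + (z₁ - r₂) * (z₂ - r₁) = 0) : ‖r₁‖ < 1 ∨ ‖r₂‖ < 1 := by
  by_contra! hr
  obtain ⟨hr₁, hr₂⟩ := hr
  have hne : ∀ {z r : ℂ}, ‖z‖ < 1 → 1 ≤ ‖r‖ → z - r ≠ 0 := by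
    intro z r hz hr h0
    rw [sub_eq_zero.1 h0] at hz
    linarith
  have hr12 : r₁ ≠ r₂ := by
    rintro rfl
    have : (z₁ - r₁) * (z₂ - r₁) = 0 := by linear_combination h / 2
    exact mul_ne_zero (hne h₁ hr₁) (hne h₂ hr₁) this
  have key : ∀ z : ℂ, ‖z‖ < 1 → ((1 - conj r₁ * r₂) * ((z - r₁) / (z - r₂))).re < 0 := by
    intro z hz
    have hid := re_harmonic_identity z r₁ r₂
    have hz2 : 0 < ‖z - r₂‖ ^ 2 := pow_pos (norm_pos_iff.2 (hne hz hr₂)) 2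
    have h12 : 0 < ‖r₁ - r₂‖ ^ 2 := pow_pos (norm_pos_iff.2 (sub_ne_zero.2 hr12)) 2
    have ha : 0 ≤ (‖r₂‖ ^ 2 - 1) * ‖z - r₁‖ ^ 2 := mul_nonneg (by nlinarith) (by positivity)
    have hb : 0 ≤ (‖r₁‖ ^ 2 - 1) * ‖z - r₂‖ ^ 2 := mul_nonneg (by nlinarith) (by positivity)
    have hc : (‖z‖ ^ 2 - 1) * ‖r₁ - r₂‖ ^ 2 < 0 :=
      mul_neg_of_neg_of_pos (by nlinarith [norm_nonneg z]) h12
    have hq : (1 - conj r₁ * r₂) * ((z - r₁) / (z - r₂)) =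
        (1 - conj r₁ * r₂) * ((z - r₁) * conj (z - r₂)) / ((‖z - r₂‖ ^ 2 : ℝ) : ℂ) := by
      push_cast
      rw [← Complex.mul_conj']
      have := hne hz hr₂
      have hcj : conj (z - r₂) ≠ 0 := (map_ne_zero _).2 this
      field_simp
    rw [hq, Complex.div_ofReal_re]
    exact div_neg_of_neg_of_pos (by linarith) hz2
  have k₁ := key z₁ h₁
  have k₂ := key z₂ h₂
  have hu : (z₁ - r₁) / (z₁ - r₂) = -((z₂ - r₁) / (z₂ - r₂)) := by
    have a := hne h₁ hr₂
    have b := hne h₂ hr₂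
    field_simp
    linear_combination h
  rw [hu, mul_neg, Complex.neg_re] at k₁
  linarith

/-- A complex line meeting the symmetrized bidisc meets it in a point `(2f, f²)`. -/
theorem exists_double_root {A B C : ℂ} {x : Fin 2 → ℂ}
    (hx : x ∈ symmetrizedDisc 2) (h : A * x 1 + B * x 0 + C = 0) :
    ∃ f : ℂ, ‖f‖ < 1 ∧ A * f ^ 2 + 2 * B * f + C = 0 := by
  obtain ⟨z₁, z₂, h₁, h₂, h0, h1⟩ := mem_symmetrizedBidisc_iff.1 hx
  rw [h0, h1] at h
  by_cases hA : A = 0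
  · refine ⟨(z₁ + z₂) / 2, ?_, ?_⟩
    · rw [norm_div, Complex.norm_two]
      linarith [norm_add_le z₁ z₂]
    · rw [hA] at h ⊢
      linear_combination h
  · obtain ⟨d, hd⟩ := IsAlgClosed.exists_eq_mul_self (B ^ 2 - A * C)
    -- The candidates for `f` are the two roots of `A X² + 2 B X + C`; incidence of `x` with the
    -- line is exactly their apolarity to `z₁, z₂`.
    have hap : (z₁ - (-B + d) / A) * (z₂ - (-B - d) / A) +
        (z₁ - (-B - d) / A) * (z₂ - (-B + d) / A) = 0 := by
      field_simp
      linear_combination 2 * A * h + 2 * hd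
    rcases norm_lt_one_of_apolar h₁ h₂ hap with hr | hr
    · refine ⟨_, hr, ?_⟩
      field_simp
      linear_combination -hd
    · refine ⟨_, hr, ?_⟩
      field_simp
      linear_combination -hd

/-- The automorphism of the symmetrized bidisc induced by the Möbius map
`z ↦ (z - f) / (1 - f̄ z)`. -/
noncomputable def bidiscAut (f : ℂ) (x : Fin 2 → ℂ) : Fin 2 → ℂ :=
  ![((1 + f * conj f) * x 0 - 2 * f - 2 * conj f * x 1) / (1 - conj f * x 0 + conj f ^ 2 * x 1),
    (x 1 - f * x 0 + f ^ 2) / (1 - conj f * x 0 + conj f ^ 2 * x 1)]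

theorem bidiscAut_denom_ne_zero {f : ℂ} (hf : ‖f‖ < 1) {x : Fin 2 → ℂ}
    (hx : x ∈ symmetrizedDisc 2) : 1 - conj f * x 0 + conj f ^ 2 * x 1 ≠ 0 := by
  have := mem_symmetrizedDisc_iff.1 hx (conj f) (by rw [Complex.norm_conj]; exact hf.le)
  rw [rootForm_two] at this
  convert! this using 1
  ring

theorem norm_moebius_lt_one {f z : ℂ} (hf : ‖f‖ < 1) (hz : ‖z‖ < 1) :
    ‖(z - f) / (1 - conj f * z)‖ < 1 := by
  have h0 : 1 - conj f * z ≠ 0 :=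
    one_sub_mul_ne_zero_of_norm (by rw [Complex.norm_conj]; exact hf.le) hz
  rw [norm_div, div_lt_one (norm_pos_iff.2 h0), ← sq_lt_sq₀ (norm_nonneg _) (norm_nonneg _)]
  have : ‖1 - conj f * z‖ ^ 2 - ‖z - f‖ ^ 2 = (1 - ‖f‖ ^ 2) * (1 - ‖z‖ ^ 2) := by
    simp only [Complex.sq_norm, Complex.normSq_apply, Complex.mul_re, Complex.mul_im,
      Complex.sub_re, Complex.sub_im, Complex.conj_re, Complex.conj_im, Complex.one_re,
      Complex.one_im]
    ring
  have : 0 < (1 - ‖f‖ ^ 2) * (1 - ‖z‖ ^ 2) :=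
    mul_pos (by nlinarith [norm_nonneg f]) (by nlinarith [norm_nonneg z])
  linarith

theorem bidiscAut_mem {f : ℂ} (hf : ‖f‖ < 1) {x : Fin 2 → ℂ} (hx : x ∈ symmetrizedDisc 2) :
    bidiscAut f x ∈ symmetrizedDisc 2 := by
  obtain ⟨z₁, z₂, h₁, h₂, h0, h1⟩ := mem_symmetrizedBidisc_iff.1 hx
  have hfc : ‖conj f‖ ≤ 1 := by rw [Complex.norm_conj]; exact hf.le
  have d₁ := one_sub_mul_ne_zero_of_norm hfc h₁
  have d₂ := one_sub_mul_ne_zero_of_norm hfc h₂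
  have hd : 1 - conj f * x 0 + conj f ^ 2 * x 1 = (1 - conj f * z₁) * (1 - conj f * z₂) := by
    rw [h0, h1]; ring
  refine mem_symmetrizedBidisc_iff.2 ⟨_, _, norm_moebius_lt_one hf h₁, norm_moebius_lt_one hf h₂,
    ?_, ?_⟩
  · simp only [bidiscAut, hd, Matrix.cons_val_zero]
    rw [h0, h1]
    field_simp
    ring
  · simp only [bidiscAut, hd, Matrix.cons_val_one, Matrix.cons_val_zero]
    rw [h0, h1]
    field_simp
    ring

theorem bidiscAut_neg_bidiscAut {f : ℂ} (hf : ‖f‖ < 1) {x : Fin 2 → ℂ}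
    (hx : x ∈ symmetrizedDisc 2) : bidiscAut (-f) (bidiscAut f x) = x := by
  have hd := bidiscAut_denom_ne_zero hf hx
  have hff : 1 - f * conj f ≠ 0 := by
    rw [mul_comm]
    exact one_sub_mul_ne_zero_of_norm (by rw [Complex.norm_conj]; exact hf.le) hf
  have hdd : 1 - conj (-f) * bidiscAut f x 0 + conj (-f) ^ 2 * bidiscAut f x 1 =
      (1 - f * conj f) ^ 2 / (1 - conj f * x 0 + conj f ^ 2 * x 1) := by
    simp only [bidiscAut, Matrix.cons_val_zero, Matrix.cons_val_one, map_neg]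
    field_simp
    ring
  ext j
  fin_cases j
  · change ((1 + -f * conj (-f)) * bidiscAut f x 0 - 2 * -f - 2 * conj (-f) * bidiscAut f x 1) /
      (1 - conj (-f) * bidiscAut f x 0 + conj (-f) ^ 2 * bidiscAut f x 1) = x 0
    rw [hdd]
    simp only [bidiscAut, Matrix.cons_val_zero, Matrix.cons_val_one, map_neg]
    field_simp
    ring
  · change (bidiscAut f x 1 - -f * bidiscAut f x 0 + (-f) ^ 2) /
      (1 - conj (-f) * bidiscAut f x 0 + conj (-f) ^ 2 * bidiscAut f x 1) = x 1
    rw [hdd, div_div_eq_mul_div, div_eq_iff (pow_ne_zero 2 hff)]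
    simp only [bidiscAut, Matrix.cons_val_zero, Matrix.cons_val_one]
    generalize hD : 1 - conj f * x 0 + conj f ^ 2 * x 1 = D at hd ⊢
    field_simp
    rw [← hD]
    ring

theorem continuousOn_bidiscAut {f : ℂ} (hf : ‖f‖ < 1) :
    ContinuousOn (bidiscAut f) (symmetrizedDisc 2) := by
  rw [continuousOn_pi]
  intro j
  fin_cases j
  · exact ContinuousOn.div (by fun_prop) (by fun_prop) fun x hx => bidiscAut_denom_ne_zero hf hx
  · exact ContinuousOn.div (by fun_prop) (by fun_prop) fun x hx => bidiscAut_denom_ne_zero hf hx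

/-- The image line has no constant term because `(2f, f²)` lies on the original line and `bidiscAut
f` sends it to `0`. -/
theorem bidiscAut_line {f : ℂ} (hf : ‖f‖ < 1) {A B C : ℂ} (h : A * f ^ 2 + 2 * B * f + C = 0)
    {x : Fin 2 → ℂ} (hx : x ∈ symmetrizedDisc 2) :
    (A + 2 * B * conj f + C * conj f ^ 2) * bidiscAut f x 1 +
      (A * f + B * (1 + f * conj f) + C * conj f) * bidiscAut f x 0 =
    (1 - f * conj f) ^ 2 * (A * x 1 + B * x 0 + C) / (1 - conj f * x 0 + conj f ^ 2 * x 1) := by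
  have hd := bidiscAut_denom_ne_zero hf hx
  simp only [bidiscAut, Matrix.cons_val_zero, Matrix.cons_val_one]
  obtain rfl : C = -(A * f ^ 2 + 2 * B * f) := by linear_combination h
  field_simp
  ring

/-- The intersection of the symmetrized bidisc with a complex line is homeomorphic to its
intersection with a complex line through the origin. -/
noncomputable def lineSectionHomeomorph {f : ℂ} (hf : ‖f‖ < 1) {A B C : ℂ}
    (h : A * f ^ 2 + 2 * B * f + C = 0) :
    {x : Fin 2 → ℂ | x ∈ symmetrizedDisc 2 ∧ A * x 1 + B * x 0 + C = 0} ≃ₜ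
    {x : Fin 2 → ℂ | x ∈ symmetrizedDisc 2 ∧
      (A + 2 * B * conj f + C * conj f ^ 2) * x 1 +
        (A * f + B * (1 + f * conj f) + C * conj f) * x 0 = 0} where
  toFun x := ⟨bidiscAut f x, bidiscAut_mem hf x.2.1, by
    rw [bidiscAut_line hf h x.2.1, x.2.2]; simp⟩
  invFun y := ⟨bidiscAut (-f) y, bidiscAut_mem (by rwa [norm_neg]) y.2.1, by
    have hf' : ‖-f‖ < 1 := by rwa [norm_neg]
    have hm := bidiscAut_mem hf' y.2.1
    have hl := bidiscAut_line hf h hm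
    have hinv := bidiscAut_neg_bidiscAut hf' y.2.1
    rw [neg_neg] at hinv
    rw [hinv, y.2.2] at hl
    have hd := bidiscAut_denom_ne_zero hf hm
    have hff : 1 - f * conj f ≠ 0 := by
      rw [mul_comm]
      exact one_sub_mul_ne_zero_of_norm (by rw [Complex.norm_conj]; exact hf.le) hf
    simpa [hd, hff] using hl.symm⟩
  left_inv x := Subtype.ext (bidiscAut_neg_bidiscAut hf x.2.1)
  right_inv y := Subtype.ext (by
    have := bidiscAut_neg_bidiscAut (f := -f) (by rwa [norm_neg]) y.2.1
    rwa [neg_neg] at this)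
  continuous_toFun := by
    refine Continuous.subtype_mk ?_ _
    exact (continuousOn_bidiscAut hf).comp_continuous continuous_subtype_val fun x => x.2.1
  continuous_invFun := by
    refine Continuous.subtype_mk ?_ _
    exact (continuousOn_bidiscAut (f := -f) (by rwa [norm_neg])).comp_continuous
      continuous_subtype_val fun x => x.2.1

theorem contractibleSpace_lineSection {A B C : ℂ}
    (hne : {x : Fin 2 → ℂ | x ∈ symmetrizedDisc 2 ∧ A * x 1 + B * x 0 + C = 0}.Nonempty) :
    ContractibleSpace {x : Fin 2 → ℂ | x ∈ symmetrizedDisc 2 ∧ A * x 1 + B * x 0 + C = 0} := by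
  obtain ⟨x, hx, hxl⟩ := hne
  obtain ⟨f, hf, h⟩ := exists_double_root hx hxl
  have e := lineSectionHomeomorph hf h
  have : ContractibleSpace {x : Fin 2 → ℂ | x ∈ symmetrizedDisc 2 ∧
      (A + 2 * B * conj f + C * conj f ^ 2) * x 1 +
        (A * f + B * (1 + f * conj f) + C * conj f) * x 0 = 0} := by
    refine StarConvex.contractibleSpace (x := 0) ?_ ⟨_, (e ⟨x, hx, hxl⟩).2⟩
    rw [starConvex_zero_iff]
    rintro y ⟨hy, hyl⟩ t ht0 ht1
    refine ⟨starConvex_zero_iff.1 starConvex_symmetrizedBidisc hy ht0 ht1, ?_⟩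
    simp only [Pi.smul_apply, Complex.real_smul]
    linear_combination (t : ℂ) * hyl
  exact e.contractibleSpace

theorem isCConvex_symmetrizedBidisc : IsCConvex (symmetrizedDisc 2) := by
  rintro L ⟨a, v, hv, rfl⟩ hne
  have hAB : -v 0 ≠ 0 ∨ v 1 ≠ 0 := by
    by_contra! h
    refine hv (funext fun j => ?_)
    fin_cases j
    · simpa using h.1
    · exact h.2
  have heq : symmetrizedDisc 2 ∩ {w | ∃ t : ℂ, w = a + t • v} =
      {x | x ∈ symmetrizedDisc 2 ∧ -v 0 * x 1 + v 1 * x 0 + (v 0 * a 1 - v 1 * a 0) = 0} := by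
    ext x
    refine and_congr_right fun _ => ⟨?_, fun h => ?_⟩
    · rintro ⟨t, rfl⟩
      simp only [Pi.add_apply, Pi.smul_apply, smul_eq_mul]
      ring
    · rcases hAB with h0 | h1
      · rw [neg_ne_zero] at h0
        refine ⟨(x 0 - a 0) / v 0, funext fun j => ?_⟩
        fin_cases j
        · simp [h0]
        · simp only [Fin.mk_one, Pi.add_apply, Pi.smul_apply, smul_eq_mul]
          field_simp
          linear_combination -h
      · refine ⟨(x 1 - a 1) / v 1, funext fun j => ?_⟩
        fin_cases j
        · simp only [Fin.zero_eta, Pi.add_apply, Pi.smul_apply, smul_eq_mul]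
          field_simp
          linear_combination h
        · simp [h1]
  rw [heq] at hne ⊢
  have := contractibleSpace_lineSection hne
  have hs : IsSimplyConnected
      {x | x ∈ symmetrizedDisc 2 ∧ -v 0 * x 1 + v 1 * x 0 + (v 0 * a 1 - v 1 * a 0) = 0} :=
    inferInstanceAs (SimplyConnectedSpace
      {x | x ∈ symmetrizedDisc 2 ∧ -v 0 * x 1 + v 1 * x 0 + (v 0 * a 1 - v 1 * a 0) = 0})
  exact ⟨hs.isPathConnected.isConnected, hs⟩

/-! ### Analytic tools: strict differentiability, a Schwarz lemma and second-order expansion. -/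

/-- Near `x`, subtracting the linear map `fderiv ℂ f x` leaves a function of small oscillation, and
the Cauchy estimate turns this into continuity of the derivative. -/
theorem hasStrictFDerivAt_of_differentiableOn {E F : Type*} [NormedAddCommGroup E]
    [NormedSpace ℂ E] [NormedAddCommGroup F] [NormedSpace ℂ F] {f : E → F} {U : Set E} {x : E}
    (hU : U ∈ 𝓝 x) (hf : DifferentiableOn ℂ f U) : HasStrictFDerivAt f (fderiv ℂ f x) x := by
  have hd : ∀ᶠ y in 𝓝 x, DifferentiableAt ℂ f y := hf.eventually_differentiableAt hU
  refine hasStrictFDerivAt_of_hasFDerivAt_of_continuousAt (f' := fderiv ℂ f)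
    (hd.mono fun y hy => hy.hasFDerivAt) ?_
  rw [Metric.continuousAt_iff]
  intro ε hε
  have hx := hd.self_of_nhds.hasFDerivAt.isLittleO.def (c := ε / 4) (by positivity)
  obtain ⟨δ, hδ, h⟩ := Metric.eventually_nhds_iff_ball.1 (hd.and hx)
  refine ⟨δ / 2, half_pos hδ, fun {y} hy => ?_⟩
  rw [dist_eq_norm] at hy ⊢
  have hsub : ∀ u ∈ ball y (δ / 2), u ∈ ball x δ := by
    intro u hu
    rw [mem_ball, dist_eq_norm] at hu ⊢
    calc ‖u - x‖ = ‖(u - y) + (y - x)‖ := by congr 1; abel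
      _ ≤ ‖u - y‖ + ‖y - x‖ := norm_add_le _ _
      _ < δ := by linarith
  have hyb : y ∈ ball y (δ / 2) := mem_ball_self (half_pos hδ)
  let g : E → F := fun u => f u - fderiv ℂ f x u
  have hg : ∀ u ∈ ball y (δ / 2), DifferentiableAt ℂ g u := fun u hu =>
    (h u (hsub u hu)).1.sub (fderiv ℂ f x).differentiableAt
  have hgy : fderiv ℂ g y = fderiv ℂ f y - fderiv ℂ f x :=
    ((h y (hsub y hyb)).1.hasFDerivAt.sub (fderiv ℂ f x).hasFDerivAt).fderiv
  have hm : Set.MapsTo g (ball y (δ / 2)) (closedBall (g y) (3 * ε / 8 * δ)) := by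
    intro u hu
    have h1 := (h u (hsub u hu)).2
    have h2 := (h y (hsub y hyb)).2
    have h3 := hsub u hu
    rw [mem_ball, dist_eq_norm] at h3
    rw [mem_closedBall, dist_eq_norm]
    calc ‖g u - g y‖ = ‖(f u - f x - fderiv ℂ f x (u - x)) -
          (f y - f x - fderiv ℂ f x (y - x))‖ := by
          congr 1
          simp only [g, map_sub]
          abel
      _ ≤ ε / 4 * ‖u - x‖ + ε / 4 * ‖y - x‖ := (norm_sub_le _ _).trans (add_le_add h1 h2)
      _ ≤ ε / 4 * δ + ε / 4 * (δ / 2) := by gcongr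
      _ = 3 * ε / 8 * δ := by ring
  rw [← hgy]
  calc ‖fderiv ℂ g y‖ ≤ 3 * ε / 8 * δ / (δ / 2) :=
        Complex.norm_fderiv_le_div_of_mapsTo_ball
          (fun u hu => (hg u hu).differentiableWithinAt) hm (half_pos hδ)
    _ = 3 * ε / 4 := by field_simp; ring
    _ < ε := by linarith

theorem norm_two_mul_sub_lt {x : Fin 2 → ℂ} (hx : x ∈ symmetrizedDisc 2) {η : ℂ} (hη : ‖η‖ = 1) :
    ‖2 * η * x 1 - x 0‖ < ‖2 - η * x 0‖ := by
  obtain ⟨z₁, z₂, h₁, h₂, h0, h1⟩ := mem_symmetrizedBidisc_iff.1 hx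
  have hid : ∀ u v : ℂ, ‖2 - u - v‖ ^ 2 - ‖2 * u * v - u - v‖ ^ 2 =
      2 * (1 - ‖u‖ ^ 2) * ‖1 - v‖ ^ 2 + 2 * (1 - ‖v‖ ^ 2) * ‖1 - u‖ ^ 2 := by
    intro u v
    simp only [Complex.sq_norm, Complex.normSq_apply, Complex.mul_re, Complex.mul_im,
      Complex.sub_re, Complex.sub_im, Complex.one_re, Complex.one_im, Complex.re_ofNat,
      Complex.im_ofNat]
    ring
  have hu : ‖η * z₁‖ < 1 := by rwa [norm_mul, hη, one_mul]
  have hv : ‖η * z₂‖ < 1 := by rwa [norm_mul, hη, one_mul]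
  have e1 : ‖2 * η * x 1 - x 0‖ = ‖2 * (η * z₁) * (η * z₂) - η * z₁ - η * z₂‖ := by
    rw [← one_mul ‖2 * η * x 1 - x 0‖, ← hη, ← norm_mul, h0, h1]
    congr 1
    ring
  have e2 : ‖2 - η * x 0‖ = ‖2 - η * z₁ - η * z₂‖ := by
    rw [h0]
    congr 1
    ring
  rw [e1, e2, ← sq_lt_sq₀ (norm_nonneg _) (norm_nonneg _)]
  have h3 : 0 < 2 * (1 - ‖η * z₁‖ ^ 2) * ‖1 - η * z₂‖ ^ 2 := by
    have h4 : 0 < ‖1 - η * z₂‖ :=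
      norm_pos_iff.2 (one_sub_mul_ne_zero_of_norm hη.le h₂)
    have : 0 < 1 - ‖η * z₁‖ ^ 2 := by nlinarith [norm_nonneg (η * z₁)]
    positivity
  have h5 : 0 ≤ 2 * (1 - ‖η * z₂‖ ^ 2) * ‖1 - η * z₁‖ ^ 2 := by
    have : 0 ≤ 1 - ‖η * z₂‖ ^ 2 := by nlinarith [norm_nonneg (η * z₂)]
    positivity
  linarith [hid (η * z₁) (η * z₂)]

theorem mul_dslope_zero {u : ℂ → ℂ} (h : u 0 = 0) (t : ℂ) : t * dslope u 0 t = u t := by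
  have := sub_smul_dslope u 0 t
  simpa [h] using this

theorem sq_mul_dslope_dslope_zero {u : ℂ → ℂ} (h : u 0 = 0) (h' : deriv u 0 = 0) (t : ℂ) :
    t ^ 2 * dslope (dslope u 0) 0 t = u t := by
  rw [sq, mul_assoc, mul_dslope_zero (by rw [dslope_same, h']), mul_dslope_zero h]

/-- A Schwarz lemma for discs `(t p(t), t² q(t))`: the pair `(p 0, q 0)` inherits the inequality of
`norm_two_mul_sub_lt`, in weak form, by the maximum principle on `‖t‖ = r` with `r → 1`. -/
theorem norm_two_mul_sub_le_of_disc {u v : ℂ → ℂ} (hu : DifferentiableOn ℂ u (ball 0 1))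
    (hv : DifferentiableOn ℂ v (ball 0 1)) (hu0 : u 0 = 0) (hv0 : v 0 = 0) (hv1 : deriv v 0 = 0)
    (hmem : ∀ t ∈ ball (0 : ℂ) 1, ![u t, v t] ∈ symmetrizedDisc 2) {η : ℂ} (hη : ‖η‖ = 1) :
    ‖2 * η * dslope (dslope v 0) 0 0 - deriv u 0‖ ≤ ‖2 - η * deriv u 0‖ := by
  have hnhds : ball (0 : ℂ) 1 ∈ 𝓝 0 := ball_mem_nhds _ one_pos
  set p := dslope u 0 with hp
  set q := dslope (dslope v 0) 0 with hq
  have hpd : DifferentiableOn ℂ p (ball 0 1) := (Complex.differentiableOn_dslope hnhds).2 hu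
  have hqd : DifferentiableOn ℂ q (ball 0 1) :=
    (Complex.differentiableOn_dslope hnhds).2 ((Complex.differentiableOn_dslope hnhds).2 hv)
  have hup : ∀ t, u t = t * p t := fun t => (mul_dslope_zero hu0 t).symm
  have hvq : ∀ t, v t = t ^ 2 * q t := fun t => (sq_mul_dslope_dslope_zero hv0 hv1 t).symm
  have hp2 : ∀ t ∈ ball (0 : ℂ) 1, ‖p t‖ ≤ 2 := by
    intro t ht
    have hm : Set.MapsTo u (ball 0 1) (closedBall (u 0) 2) := by
      intro t ht
      obtain ⟨z₁, z₂, h₁, h₂, h0, -⟩ := mem_symmetrizedBidisc_iff.1 (hmem t ht)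
      rw [mem_closedBall, hu0, dist_zero_right]
      have h0 : u t = z₁ + z₂ := h0
      rw [h0]
      linarith [norm_add_le z₁ z₂]
    simpa using Complex.norm_dslope_le_div_of_mapsTo_ball hu hm ht
  have hpu : deriv u 0 = p 0 := (dslope_same u 0).symm
  rw [hpu]
  have key : ∀ r ∈ Set.Ioo (0 : ℝ) 1,
      r * ‖2 * (r * η) * q 0 - p 0‖ ≤ ‖2 - r * η * p 0‖ := by
    rintro r ⟨hr0, hr1⟩
    have hsub : closedBall (0 : ℂ) r ⊆ ball 0 1 := closedBall_subset_ball hr1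
    have hrη : ‖(r : ℂ) * η‖ = r := by
      rw [norm_mul, hη, mul_one, Complex.norm_real, Real.norm_eq_abs, abs_of_pos hr0]
    have hden : ∀ t ∈ closedBall (0 : ℂ) r, 2 - r * η * p t ≠ 0 := by
      intro t ht h0
      have h1 := congrArg norm (sub_eq_zero.1 h0)
      rw [norm_mul, hrη, Complex.norm_two] at h1
      nlinarith [hp2 t (hsub ht), norm_nonneg (p t)]
    let F : ℂ → ℂ := fun t => (2 * (r * η) * q t - p t) / (2 - r * η * p t)
    have hF : DifferentiableOn ℂ F (closedBall 0 r) := by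
      have h1 := hpd.mono hsub
      have h2 := hqd.mono hsub
      exact ((h2.const_mul _).sub h1).div ((differentiableOn_const _).sub (h1.const_mul _)) hden
    have hbd : ∀ t ∈ frontier (ball (0 : ℂ) r), ‖F t‖ ≤ 1 / r := by
      intro t ht
      rw [frontier_ball _ hr0.ne', mem_sphere_zero_iff_norm] at ht
      have htb : t ∈ closedBall (0 : ℂ) r := by simp [ht]
      have ht0 : t ≠ 0 := by rw [← norm_pos_iff, ht]; exact hr0
      -- The unimodular parameter `r η / t` varies with `t` so that the powers of `t` cancel down to
      -- one factor, of modulus `r`; this is why the bound is `1 / r`.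
      have h1 := norm_two_mul_sub_lt (hmem t (hsub htb)) (η := r * η / t)
        (by rw [norm_div, hrη, ht, div_self hr0.ne'])
      simp only [Matrix.cons_val_zero, Matrix.cons_val_one, hup t, hvq t] at h1
      have e1 : 2 * (r * η / t) * (t ^ 2 * q t) - t * p t = t * (2 * (r * η) * q t - p t) := by
        field_simp
      have e2 : 2 - r * η / t * (t * p t) = 2 - r * η * p t := by
        field_simp
      rw [e1, e2, norm_mul, ht] at h1
      rw [norm_div, div_le_div_iff₀ (norm_pos_iff.2 (hden t htb)) hr0]
      linarith
    have h0 := Complex.norm_le_of_forall_mem_frontier_norm_le isBounded_ball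
      (hF.diffContOnCl_ball subset_rfl) hbd (subset_closure (mem_ball_self hr0))
    rw [norm_div, div_le_div_iff₀ (norm_pos_iff.2 (hden 0 (by simp [hr0.le]))) hr0] at h0
    linarith
  have hc1 : Tendsto (fun r : ℝ => r * ‖2 * (r * η) * q 0 - p 0‖) (𝓝[<] 1)
      (𝓝 (1 * ‖2 * ((1 : ℝ) * η) * q 0 - p 0‖)) :=
    (Continuous.tendsto (by fun_prop) _).mono_left nhdsWithin_le_nhds
  have hc2 : Tendsto (fun r : ℝ => ‖2 - r * η * p 0‖) (𝓝[<] 1)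
      (𝓝 ‖2 - (1 : ℝ) * η * p 0‖) :=
    Tendsto.mono_left (Continuous.tendsto (f := fun r : ℝ => ‖2 - r * η * p 0‖) (by fun_prop) _)
      nhdsWithin_le_nhds
  have := le_of_tendsto_of_tendsto hc1 hc2
    (mem_of_superset (Ioo_mem_nhdsLT one_pos) key)
  simpa using this

/-- The weighted dilation `(λ s, λ² p)` of a point `(s, p)`. -/
def weightedDilation (a : Fin 2 → ℂ) (t : ℂ) : Fin 2 → ℂ := ![t * a 0, t ^ 2 * a 1]

/-- Strict differentiability handles the step from `(tα, 0)` to `(tα, t²β)`, of size `O(t²)`; along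
the first axis the one-variable Taylor expansion contributes `c α²`, where `c` is its quadratic
coefficient. -/
theorem exists_second_order_coeff {U : Set (Fin 2 → ℂ)} (hU : IsOpen U) (h0 : 0 ∈ U)
    {l : (Fin 2 → ℂ) → ℂ} (hl : DifferentiableOn ℂ l U)
    (hl' : HasFDerivAt l (ContinuousLinearMap.proj (R := ℂ) (φ := fun _ : Fin 2 => ℂ) 1) 0) :
    ∃ c : ℂ, ∀ α β : ℂ → ℂ, ContinuousAt α 0 → ContinuousAt β 0 →
      Tendsto (fun t => (l ![t * α t, t ^ 2 * β t] - l 0) / t ^ 2) (𝓝[≠] 0)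
        (𝓝 (β 0 + c * α 0 ^ 2)) := by
  have hstrict := hasStrictFDerivAt_of_differentiableOn (hU.mem_nhds h0) hl
  rw [hl'.fderiv] at hstrict
  let i : ℂ → Fin 2 → ℂ := fun x => ![x, 0]
  have hi : Differentiable ℂ i := by
    rw [differentiable_pi]
    intro j
    fin_cases j
    · exact differentiable_id
    · exact differentiable_const _
  have hi0 : i 0 = 0 := by ext j; fin_cases j <;> rfl
  have hi' : HasDerivAt i ![1, 0] 0 := by
    rw [hasDerivAt_pi]
    intro j
    fin_cases j
    · exact hasDerivAt_id _
    · exact hasDerivAt_const _ _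
  let u : ℂ → ℂ := fun x => l (i x) - l 0
  have hV : i ⁻¹' U ∈ 𝓝 0 :=
    hi.continuous.continuousAt.preimage_mem_nhds (hU.mem_nhds (by rwa [hi0]))
  have hu : DifferentiableOn ℂ u (i ⁻¹' U) :=
    (hl.comp hi.differentiableOn fun x hx => hx).sub_const _
  have hu0 : u 0 = 0 := by simp [u, hi0]
  have hu1 : deriv u 0 = 0 := by
    have h1 : HasDerivAt u _ 0 :=
      ((by rwa [hi0] : HasFDerivAt l _ (i 0)).comp_hasDerivAt 0 hi').sub_const (l 0)
    rw [h1.deriv]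
    simp
  let w := dslope (dslope u 0) 0
  have hw : ContinuousAt w 0 :=
    (((Complex.differentiableOn_dslope hV).2 ((Complex.differentiableOn_dslope hV).2 hu)
      ).continuousOn).continuousAt hV
  have huw : ∀ x, u x = x ^ 2 * w x := fun x => (sq_mul_dslope_dslope_zero hu0 hu1 x).symm
  refine ⟨w 0, fun α β hα hβ => ?_⟩
  have hidt : Tendsto (fun t : ℂ => t) (𝓝[≠] 0) (𝓝 0) := tendsto_id.mono_left nhdsWithin_le_nhds
  have hα' : Tendsto α (𝓝[≠] 0) (𝓝 (α 0)) := hα.tendsto.mono_left nhdsWithin_le_nhds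
  have hβ' : Tendsto β (𝓝[≠] 0) (𝓝 (β 0)) := hβ.tendsto.mono_left nhdsWithin_le_nhds
  have hta : Tendsto (fun t => t * α t) (𝓝[≠] 0) (𝓝 0) := by simpa using hidt.mul hα'
  have htb : Tendsto (fun t => t ^ 2 * β t) (𝓝[≠] 0) (𝓝 0) := by simpa using (hidt.pow 2).mul hβ'
  have hx : Tendsto (fun t => ![t * α t, t ^ 2 * β t]) (𝓝[≠] 0) (𝓝 (0 : Fin 2 → ℂ)) := by
    rw [tendsto_pi_nhds]
    intro j
    fin_cases j
    · exact hta
    · exact htb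
  have hy : Tendsto (fun t => i (t * α t)) (𝓝[≠] 0) (𝓝 (0 : Fin 2 → ℂ)) := by
    have := (hi.continuous.tendsto 0).comp hta
    rwa [hi0] at this
  have ho := hstrict.isLittleO.comp_tendsto (hx.prodMk_nhds hy)
  have hdiff : ∀ t, ![t * α t, t ^ 2 * β t] - i (t * α t) = ![0, t ^ 2 * β t] := by
    intro t
    ext j
    fin_cases j <;> simp [i]
  have hO : (fun t => ![t * α t, t ^ 2 * β t] - i (t * α t)) =O[𝓝[≠] 0] fun t : ℂ => t ^ 2 := by
    have h1 : (fun t => ![t * α t, t ^ 2 * β t] - i (t * α t)) =O[𝓝[≠] 0]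
        fun t : ℂ => t ^ 2 * β t := by
      refine Asymptotics.IsBigO.of_bound 1 (Eventually.of_forall fun t => ?_)
      rw [hdiff, one_mul, pi_norm_le_iff_of_nonneg (norm_nonneg _)]
      intro j
      fin_cases j
      · simpa using mul_nonneg (sq_nonneg ‖t‖) (norm_nonneg (β t))
      · simp
    refine h1.trans ?_
    simpa using (Asymptotics.isBigO_refl (fun t : ℂ => t ^ 2) (𝓝[≠] 0)).mul (hβ'.isBigO_one ℂ)
  have hlim := (ho.trans_isBigO hO).tendsto_div_nhds_zero
  have hlim2 : Tendsto (fun t => α t ^ 2 * w (t * α t)) (𝓝[≠] 0) (𝓝 (α 0 ^ 2 * w 0)) :=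
    (hα'.pow 2).mul (hw.tendsto.comp hta)
  have hsum := (hlim.add hβ').add hlim2
  rw [zero_add, mul_comm (α 0 ^ 2)] at hsum
  refine hsum.congr' ?_
  filter_upwards [self_mem_nhdsWithin] with t ht
  have ht : t ≠ 0 := ht
  have e1 := huw (t * α t)
  simp only [u] at e1
  simp only [Function.comp_apply, hdiff, ContinuousLinearMap.proj_apply, Matrix.cons_val_one,
    Matrix.cons_val_zero]
  field_simp
  linear_combination -e1

/-! ### The obstruction to exhaustion by biholomorphic images of convex domains. -/

theorem fderiv_comp_of_leftInvOn {U V : Set (Fin 2 → ℂ)} (hU : IsOpen U) (hV : IsOpen V)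
    {f g : (Fin 2 → ℂ) → (Fin 2 → ℂ)} (hf : DifferentiableOn ℂ f U) (hg : DifferentiableOn ℂ g V)
    (hm : Set.MapsTo f U V) (hinv : Set.LeftInvOn g f U) {x : Fin 2 → ℂ} (hx : x ∈ U) :
    (fderiv ℂ g (f x)).comp (fderiv ℂ f x) = ContinuousLinearMap.id ℂ _ := by
  have h1 := (hf.differentiableAt (hU.mem_nhds hx)).hasFDerivAt
  have h2 := (hg.differentiableAt (hV.mem_nhds (hm hx))).hasFDerivAt
  refine (h2.comp x h1).unique ((hasFDerivAt_id x).congr_of_eventuallyEq ?_)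
  filter_upwards [hU.mem_nhds hx] with y hy using hinv hy

/-- If a subdomain of the symmetrized bidisc is biholomorphic to a convex domain then, up to a
shear, midpoints of its circular points satisfy the inequalities of the closed symmetrized
bidisc. -/
theorem exists_shear_midpoint {U G : Set (Fin 2 → ℂ)} (hU : IsOpen U) (h0 : 0 ∈ U)
    (hUsub : U ⊆ symmetrizedDisc 2) (hG : IsOpen G) (hGc : Convex ℝ G)
    (hbi : IsBiholomorphicTo U G) :
    ∃ c : ℂ, ∀ a b : Fin 2 → ℂ, (∀ t ∈ ball (0 : ℂ) 1, weightedDilation a t ∈ U) →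
      (∀ t ∈ ball (0 : ℂ) 1, weightedDilation b t ∈ U) → ∀ η : ℂ, ‖η‖ = 1 →
      ‖2 * η * ((a 1 + b 1) / 2 + c * (a 0 - b 0) ^ 2 / 4) - (a 0 + b 0) / 2‖ ≤
        ‖2 - η * ((a 0 + b 0) / 2)‖ := by
  obtain ⟨f, g, hf, hg, hfm, hgm, hgf, hfg⟩ := hbi
  set A := fderiv ℂ g (f 0) with hA
  have hAB : ∀ x, A (fderiv ℂ f 0 x) = x := fun x => by
    have := DFunLike.congr_fun (fderiv_comp_of_leftInvOn hU hG hf hg hfm hgf h0) x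
    simpa using this
  -- Composing with the inverse derivative normalizes the second component of `f` to have linear
  -- part `proj 1`, as the second-order expansion requires.
  let l : (Fin 2 → ℂ) → ℂ := fun x => A (f x) 1
  have hl : DifferentiableOn ℂ l U := fun x hx =>
    differentiableWithinAt_pi.1 (A.differentiableAt.comp_differentiableWithinAt x (hf x hx)) 1
  have hf0 := (hf.differentiableAt (hU.mem_nhds h0)).hasFDerivAt
  have hl' : HasFDerivAt l
      (ContinuousLinearMap.proj (R := ℂ) (φ := fun _ : Fin 2 => ℂ) 1) 0 := by
    have h1 := hasFDerivAt_pi'.1 (A.hasFDerivAt.comp 0 hf0) 1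
    refine h1.congr_fderiv ?_
    ext1 x
    simp [hAB]
  obtain ⟨c, hc⟩ := exists_second_order_coeff hU h0 hl hl'
  refine ⟨c, fun a b ha hb η hη => ?_⟩
  have hwd : ∀ a : Fin 2 → ℂ, Differentiable ℂ (weightedDilation a) := by
    intro a
    rw [differentiable_pi]
    intro j
    fin_cases j
    · exact differentiable_id.mul_const _
    · exact (differentiable_id.pow 2).mul_const _
  have hw0 : ∀ a : Fin 2 → ℂ, weightedDilation a 0 = 0 := by
    intro a
    ext j
    fin_cases j <;> simp [weightedDilation]
  have hw' : ∀ a : Fin 2 → ℂ, HasDerivAt (weightedDilation a) ![a 0, 0] 0 := by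
    intro a
    rw [hasDerivAt_pi]
    intro j
    fin_cases j
    · simpa [weightedDilation] using (hasDerivAt_id (0 : ℂ)).mul_const (a 0)
    · simpa [weightedDilation] using ((hasDerivAt_id (0 : ℂ)).pow 2).mul_const (a 1)
  let m : ℂ → Fin 2 → ℂ := fun t =>
    (1 / 2 : ℂ) • (f (weightedDilation a t) + f (weightedDilation b t))
  have hmG : Set.MapsTo m (ball 0 1) G := by
    intro t ht
    have := hGc (hfm (ha t ht)) (hfm (hb t ht)) (a := 1 / 2) (b := 1 / 2)
      (by norm_num) (by norm_num) (by norm_num)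
    convert! this using 1
    ext j
    simp [m, Complex.real_smul]
  have hmd : DifferentiableOn ℂ m (ball 0 1) :=
    ((hf.comp (hwd a).differentiableOn ha).add
      (hf.comp (hwd b).differentiableOn hb)).const_smul (1 / 2 : ℂ)
  have hm0 : m 0 = f 0 := by
    simp only [m, hw0]
    rw [← two_smul ℂ (f 0), smul_smul]
    norm_num
  have hm' : HasDerivAt m ((1 / 2 : ℂ) • (fderiv ℂ f 0 ![a 0, 0] + fderiv ℂ f 0 ![b 0, 0])) 0 := by
    have h1 : ∀ a, HasDerivAt (fun t => f (weightedDilation a t)) (fderiv ℂ f 0 ![a 0, 0]) 0 :=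
      fun a => (by rwa [hw0] : HasFDerivAt f _ (weightedDilation a 0)).comp_hasDerivAt 0 (hw' a)
    exact ((h1 a).add (h1 b)).const_smul (1 / 2 : ℂ)
  -- The averaged disc lies in `G` by convexity. Its pullback is tangent at `0` to the first axis,
  -- so the Schwarz lemma applies to it.
  let Ψ : ℂ → Fin 2 → ℂ := fun t => g (m t)
  have hΨd : DifferentiableOn ℂ Ψ (ball 0 1) := hg.comp hmd hmG
  have hΨU : ∀ t ∈ ball (0 : ℂ) 1, Ψ t ∈ U := fun t ht => hgm (hmG ht)
  have hΨ0 : Ψ 0 = 0 := by simp only [Ψ, hm0]; exact hgf h0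
  have hΨ' : HasDerivAt Ψ ((1 / 2 : ℂ) • (![a 0, 0] + ![b 0, 0])) 0 := by
    have h1 : HasFDerivAt g A (m 0) := by
      rw [hm0]
      exact (hg.differentiableAt (hG.mem_nhds (hfm h0))).hasFDerivAt
    have := h1.comp_hasDerivAt 0 hm'
    rwa [map_smul, map_add, hAB, hAB] at this
  have hΨ0' := hasDerivAt_pi.1 hΨ' 0
  have hΨ1' := hasDerivAt_pi.1 hΨ' 1
  let u : ℂ → ℂ := fun t => Ψ t 0
  let v : ℂ → ℂ := fun t => Ψ t 1
  have hu : DifferentiableOn ℂ u (ball 0 1) := differentiableOn_pi.1 hΨd 0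
  have hv : DifferentiableOn ℂ v (ball 0 1) := differentiableOn_pi.1 hΨd 1
  have hu0 : u 0 = 0 := congrFun hΨ0 0
  have hv0 : v 0 = 0 := congrFun hΨ0 1
  have hu1 : deriv u 0 = (a 0 + b 0) / 2 := by
    rw [hΨ0'.deriv]
    simp only [Pi.smul_apply, Pi.add_apply, Matrix.cons_val_zero, smul_eq_mul]
    ring
  have hv1 : deriv v 0 = 0 := by
    rw [hΨ1'.deriv]
    simp
  have huv : ∀ t, ![u t, v t] = Ψ t := fun t => by ext j; fin_cases j <;> rfl
  have hnhds : ball (0 : ℂ) 1 ∈ 𝓝 0 := ball_mem_nhds _ one_pos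
  have hbound := norm_two_mul_sub_le_of_disc hu hv hu0 hv0 hv1
    (fun t ht => by rw [huv]; exact hUsub (hΨU t ht)) hη
  have hcu : ContinuousAt (dslope u 0) 0 :=
    ((Complex.differentiableOn_dslope hnhds).2 hu).continuousOn.continuousAt hnhds
  have hcv : ContinuousAt (dslope (dslope v 0) 0) 0 :=
    ((Complex.differentiableOn_dslope hnhds).2
      ((Complex.differentiableOn_dslope hnhds).2 hv)).continuousOn.continuousAt hnhds
  have L1 := hc _ _ hcu hcv
  simp only [mul_dslope_zero hu0, sq_mul_dslope_dslope_zero hv0 hv1, huv] at L1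
  have L2 := hc _ _ (continuousAt_const (y := a 0)) (continuousAt_const (y := a 1))
  have L3 := hc _ _ (continuousAt_const (y := b 0)) (continuousAt_const (y := b 1))
  have hrel : ∀ t ∈ ball (0 : ℂ) 1, l (Ψ t) =
      (l (weightedDilation a t) + l (weightedDilation b t)) / 2 := by
    intro t ht
    have h1 : f (Ψ t) = m t := hfg (hmG ht)
    simp only [l, h1, m, map_smul, map_add, Pi.smul_apply, Pi.add_apply, smul_eq_mul]
    ring
  have L4 := (L2.add L3).div_const 2
  have L5 := L4.congr' (f₂ := fun t => (l (Ψ t) - l 0) / t ^ 2) (by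
    filter_upwards [nhdsWithin_le_nhds hnhds] with t ht
    rw [hrel t ht]
    simp only [weightedDilation]
    ring)
  have heq := tendsto_nhds_unique L1 L5
  rw [dslope_same u, hu1] at heq
  rw [hu1] at hbound
  -- The correction is `c` times the mean of the squares minus the square of the mean of `a 0` and
  -- `b 0`.
  have hq : dslope (dslope v 0) 0 0 = (a 1 + b 1) / 2 + c * (a 0 - b 0) ^ 2 / 4 := by
    linear_combination heq
  rwa [hq] at hbound

theorem weightedDilation_symmMap (z : Fin 2 → ℂ) (t : ℂ) :
    weightedDilation (symmMap 2 z) t = symmMap 2 (t • z) := by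
  rw [symmMap_two, symmMap_two]
  ext j
  fin_cases j
  · simp [weightedDilation, mul_add]
  · simp [weightedDilation]; ring

/-- With `99 / 100` replaced by `1`, `hA` and `hB` read `‖2c - 1‖ ≤ 1` and `‖1 + 4c‖ ≤ 1`: two discs
tangent at `c = 0`. Then `hC` would give `√2 ≤ ‖2 - (7 - i)/5‖`, which is false. The margin is wide
enough for `99 / 100`. -/
theorem no_common_shear_coeff (c : ℂ)
    (hA : ‖2 * c * (99 / 100) ^ 2 - 99 / 100‖ ≤ ‖(2 : ℂ) - 99 / 100‖)
    (hB : ‖(2 : ℂ) * ((99 / 100) ^ 2 + c * (4 * (99 / 100)) ^ 2 / 4)‖ ≤ 2)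
    (hC : ‖2 * ((3 - 4 * Complex.I) / 5) * (-2 * Complex.I * c * (99 / 100) ^ 2) -
      (1 + Complex.I) * (99 / 100)‖ ≤
        ‖2 - (3 - 4 * Complex.I) / 5 * ((1 + Complex.I) * (99 / 100))‖) : False := by
  have hc : ‖c‖ ≤ 1 / 10 := by
    have hA2 := (sq_le_sq₀ (norm_nonneg _) (norm_nonneg _)).2 hA
    have hB2 := (sq_le_sq₀ (norm_nonneg _) zero_le_two).2 hB
    rw [← sq_le_sq₀ (norm_nonneg _) (by norm_num), Complex.sq_norm, Complex.normSq_apply]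
    rw [show (2 : ℂ) - 99 / 100 = ((101 / 100 : ℝ) : ℂ) by push_cast; norm_num,
      show 2 * c * (99 / 100) ^ 2 - 99 / 100 =
        ((2 * (99 / 100) ^ 2 : ℝ) : ℂ) * c - ((99 / 100 : ℝ) : ℂ) by push_cast; ring,
      Complex.sq_norm, Complex.sq_norm, Complex.normSq_apply, Complex.normSq_apply] at hA2
    rw [show (2 : ℂ) * ((99 / 100) ^ 2 + c * (4 * (99 / 100)) ^ 2 / 4) =
        ((2 * (99 / 100) ^ 2 : ℝ) : ℂ) + ((8 * (99 / 100) ^ 2 : ℝ) : ℂ) * c by push_cast; ring,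
      Complex.sq_norm, Complex.normSq_apply] at hB2
    simp only [Complex.sub_re, Complex.sub_im, Complex.add_re, Complex.add_im, Complex.re_ofReal_mul,
      Complex.im_ofReal_mul, Complex.ofReal_re, Complex.ofReal_im] at hA2 hB2
    -- The terms in `Re c` have opposite signs in the two squared inequalities, so a positive
    -- combination eliminates them and bounds `‖c‖²`.
    nlinarith [sq_nonneg c.re, sq_nonneg c.im]
  have e1 : ‖2 * ((3 - 4 * Complex.I) / 5) * (-2 * Complex.I * c * (99 / 100) ^ 2)‖ ≤ 2 / 5 := by
    have h5 : ‖(3 - 4 * Complex.I) / 5‖ = 1 := by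
      rw [← sq_eq_sq₀ (norm_nonneg _) zero_le_one, Complex.sq_norm, Complex.normSq_apply]
      norm_num
    rw [norm_mul, norm_mul, h5]
    simp only [norm_mul, norm_neg, norm_pow, norm_div, Complex.norm_I, Complex.norm_ofNat]
    nlinarith [norm_nonneg c]
  have e2 : ‖2 - (3 - 4 * Complex.I) / 5 * ((1 + Complex.I) * (99 / 100))‖ ≤ 7 / 10 := by
    rw [← sq_le_sq₀ (norm_nonneg _) (by norm_num), Complex.sq_norm, Complex.normSq_apply]
    norm_num
  have e3 : 13 / 10 ≤ ‖(1 + Complex.I) * (99 / 100)‖ := by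
    rw [← sq_le_sq₀ (by norm_num) (norm_nonneg _), Complex.sq_norm, Complex.normSq_apply]
    norm_num
  have e4 := norm_sub_norm_le ((1 + Complex.I) * (99 / 100))
    (2 * ((3 - 4 * Complex.I) / 5) * (-2 * Complex.I * c * (99 / 100) ^ 2))
  rw [norm_sub_rev] at e4
  linarith

theorem not_inClassE_symmetrizedBidisc : ¬ InClassE (symmetrizedDisc 2) := by
  rintro ⟨-, hE⟩
  let P : Set (Fin 2 → ℂ) := Set.univ.pi fun _ => closedBall 0 (99 / 100)
  have hmemP : ∀ {z : Fin 2 → ℂ}, z ∈ P ↔ ∀ j, ‖z j‖ ≤ 99 / 100 := by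
    intro z
    simp [P]
  have hP : IsCompact P := isCompact_univ_pi fun _ => isCompact_closedBall _ _
  have hK : symmMap 2 '' P ⊆ symmetrizedDisc 2 := by
    rintro _ ⟨z, hz, rfl⟩
    exact ⟨z, fun j => (hmemP.1 hz j).trans_lt (by norm_num), rfl⟩
  obtain ⟨U, hUdom, hKU, hUsub, G, hGdom, hGc, hbi⟩ :=
    hE _ (hP.image (continuous_symmMap 2)) hK
  have hdil : ∀ z ∈ P, ∀ t ∈ ball (0 : ℂ) 1, weightedDilation (symmMap 2 z) t ∈ U := by
    intro z hz t ht
    rw [weightedDilation_symmMap]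
    refine hKU ⟨_, hmemP.2 fun j => ?_, rfl⟩
    rw [mem_ball_zero_iff] at ht
    rw [Pi.smul_apply, norm_smul]
    nlinarith [hmemP.1 hz j, norm_nonneg t, norm_nonneg (z j)]
  have h0 : (0 : Fin 2 → ℂ) ∈ U := by
    refine hKU ⟨0, hmemP.2 fun j => by norm_num, ?_⟩
    rw [symmMap_two]
    ext j
    fin_cases j <;> simp
  obtain ⟨c, hc⟩ := exists_shear_midpoint hUdom.1 h0 hUsub hGdom.1 hGc hbi
  have hpair : ∀ z₁ z₂ : ℂ, ‖z₁‖ ≤ 99 / 100 → ‖z₂‖ ≤ 99 / 100 →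
      ∀ t ∈ ball (0 : ℂ) 1, weightedDilation ![z₁ + z₂, z₁ * z₂] t ∈ U := by
    intro z₁ z₂ h₁ h₂
    have := hdil ![z₁, z₂] (hmemP.2 fun j => by fin_cases j <;> simpa)
    simpa only [symmMap_two, Matrix.cons_val_zero, Matrix.cons_val_one] using this
  have hρ : ‖(99 / 100 : ℂ)‖ ≤ 99 / 100 := by simp
  have hρ' : ‖-(99 / 100 : ℂ)‖ ≤ 99 / 100 := by rwa [norm_neg]
  have hρi : ‖Complex.I * (99 / 100)‖ ≤ 99 / 100 := by
    rwa [norm_mul, Complex.norm_I, one_mul]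
  -- With `ρ = 99/100`, the root pair `(ρ, ρ)` is averaged with `(ρ, -ρ)`, `(-ρ, -ρ)` and `(iρ,
  -- iρ)`. In the last case `η` is a rational point of the unit circle chosen to turn `1 + i` close
  -- to the positive real axis.
  have tA := hc _ _ (hpair _ _ hρ hρ) (hpair _ _ hρ hρ') 1 norm_one
  have tB := hc _ _ (hpair _ _ hρ hρ) (hpair _ _ hρ' hρ') 1 norm_one
  have tC := hc _ _ (hpair _ _ hρ hρ) (hpair _ _ hρi hρi) ((3 - 4 * Complex.I) / 5) (by
    rw [← sq_eq_sq₀ (norm_nonneg _) zero_le_one, Complex.sq_norm, Complex.normSq_apply]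
    norm_num)
  simp only [Matrix.cons_val_zero, Matrix.cons_val_one] at tA tB tC
  have hI := Complex.I_sq
  refine no_common_shear_coeff c ?_ ?_ ?_
  · convert! tA using 2 <;> ring
  · convert! tB using 1
    · congr 1; ring
    · norm_num
  · convert! tC using 2
    · linear_combination (-(2 * ((3 - 4 * Complex.I) / 5)) *
        (c * (99 / 100) ^ 2 + (99 / 100) ^ 2 / 2)) * hI
    · ring

theorem not_isBiholomorphicToConvex_symmetrizedBidisc :
    ¬ IsBiholomorphicToConvex (symmetrizedDisc 2) := fun h =>
  not_inClassE_symmetrizedBidisc ⟨isDomainIn_symmetrizedDisc 2, fun _ _ hK =>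
    ⟨_, isDomainIn_symmetrizedDisc 2, hK, subset_rfl, h⟩⟩

theorem theoremc :
    ((IsDomainIn (symmetrizedDisc 2) ∧ IsCConvex (symmetrizedDisc 2)) ∧
      ¬ InClassE (symmetrizedDisc 2) ∧
      ¬ IsBiholomorphicToConvex (symmetrizedDisc 2)) ∧
    (∀ n : ℕ, 3 ≤ n →
      (IsDomainIn (symmetrizedDisc n) ∧ IsLinearlyConvex (symmetrizedDisc n)) ∧
      ¬ IsCConvex (symmetrizedDisc n) ∧
      ∃ L : Set (Fin n → ℂ), IsComplexLine L ∧
        ¬ IsPreconnected (symmetrizedDisc n ∩ L)) :=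
  ⟨⟨⟨isDomainIn_symmetrizedDisc 2, isCConvex_symmetrizedBidisc⟩, not_inClassE_symmetrizedBidisc,
      not_isBiholomorphicToConvex_symmetrizedBidisc⟩,
    fun n hn => ⟨⟨isDomainIn_symmetrizedDisc n, isLinearlyConvex_symmetrizedDisc n⟩,
      not_isCConvex_symmetrizedDisc hn,
      exists_line_inter_symmetrizedDisc_not_isPreconnected hn⟩⟩
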